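/- Let $d\ge 1$ be an integer and $\rho\in[0,1]$ with $d\rho^2>1$ (the Kesten–Stigum regime). In the Ising broadcast process on the $d$-ary tree $T_{d,h}$ of height $h$, the root spin is uniform on $\{\pm1\}$ and, given the spins at one level, the spins at the next level are independent, each being equal to its parent's spin with probability $\frac{1+\rho}{2}$ and opposite to it with probability $\frac{1-\rho}{2}$. For $0\le w\le h$, the autoregressive process with context depth $w$ generates blocks $Y_1,\dots,Y_{d^{h-w}}\in\{\pm1\}^{d^w}$ and outputs $X_L=(Y_1,\dots,Y_{d^{h-w}})\in\{\pm1\}^{d^h}$, as follows. $Y_1$ has the law of the leaves of a height-$w$ subtree in the broadcast process on $T_{d,h}$. For $r\ge2$, one samples independently a height $h_r\in\{1,\dots,h-w\}$ with the law of the height (above level $h-w$) of the least common ancestor of a uniformly random pair of consecutive nodes at level $h-w$ of $T_{d,h}$, and then samples $Y_r$ from the conditional law, in the broadcast process, of the leaves of a height-$w$ subtree, given that the preceding adjacent height-$w$ subtree has leaves $Y_{r-1}$ and that the least common ancestor of the two subtrees has height exactly $h_r$. Let $q_h=\mathbb E\big[\mathbb E[X\mid Y]^2\big]$, where $X$ is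 the root spin and $Y$ are the leaves of the Ising broadcast process on $T_{d,h}$, and put $$\alpha^*=\sum_{k\ge1}\Big(1-\frac1d\Big)\frac{1}{d^{k-1}}\,\rho^{2k},\qquad C_{d,\rho}(2)=\Big(1-\frac1d\Big)\frac{d\rho^2}{d\rho^2-1}.$$ Then: 1. The limit $q^*=\lim_{h\to\infty}q_h$ exists, and $C_{d,\rho}(2)>0$. 2. If $\rho<1$, put $A_{d,\rho}(2)=C_{d,\rho}(2)+\dfrac{2\alpha^*}{1-\alpha^*q^*}$. Then $C_{d,\rho}(2)\le A_{d,\rho}(2)$, and, if $X_L$ is a sample of the autoregressive process, as $w\to\infty$ and $h-w\to\infty$, $$\log\Big(d^{-h}\,\mathrm{Var}\Big(\sum_{i=1}^{d^h}(X_L)_i\Big)\Big)=w\log(d\rho^2)+\log A_{d,\rho}(2)+o(1).$$ 3. If $X_L$ denotes instead the leaves of the true Ising broadcast process on $T_{d,h}$ then, as $h\to\infty$, $$\log\Big(d^{-h}\,\mathrm{Var}\Big(\sum_{i=1}^{d^h}(X_L)_i\Big)\Big)=h\log(d\rho^2)+\log C_{d,\rho}(2)+o(1).$$ -/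

import Mathlib

noncomputable section

namespace Broadcast

open scoped ENNReal

/-- The law of a family of independent random variables `Y i ∼ p i` over a finite index set. -/
def independentLaw {ι S : Type} [Fintype ι] [DecidableEq ι] [Fintype S] (p : ι → PMF S) :
    PMF (ι → S) :=
  PMF.ofFintype (fun y => ∏ i, p i (y i)) (by
    rw [← Fintype.prod_sum (fun i s => p i s)]
    refine Finset.prod_eq_one fun i _ => ?_
    exact (tsum_fintype (p i)).symm.trans (p i).tsum_coe)

/-- The conditional law of the second coordinate given that the first coordinate equals `a`,
under a discrete joint law. (If `a` has probability zero, the value is irrelevant.) -/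
def condLaw {α β : Type} (p : PMF (α × β)) (a : α) : PMF β :=
  open Classical in
  if h : (∑' b, p (a, b)) ≠ 0 then
    PMF.normalize (fun b => p (a, b)) h
      (ne_top_of_le_ne_top p.tsum_coe_ne_top
        (ENNReal.tsum_comp_le_tsum_of_injective (Prod.mk_right_injective a) p))
  else p.map Prod.snd

/-! ### The broadcast process on the `d`-ary tree

The `d ^ ℓ` nodes at level `ℓ` are numbered `0, …, d ^ ℓ - 1` from left to right: the node `r` has
the children `d * r, …, d * r + d - 1` at level `ℓ + 1`. The `ℓ` base-`d` digits of `r`, most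
significant digit first, spell the path in `[d] ^ ℓ` from the root to `r`. -/

/-- The parent of a node at level `ℓ + 1`. -/
def parent (d ℓ : ℕ) (r : Fin (d ^ (ℓ + 1))) : Fin (d ^ ℓ) :=
  ⟨r.1 / d, Nat.div_lt_of_lt_mul (by rw [mul_comm, ← pow_succ]; exact r.2)⟩

/-- The law of the values at level `h` of the broadcast process with channel `κ`, given that the
root has the value `x`: given the values at a level, the values at the next level are
independent, the one at `r` having the law `κ (value at the parent of r)`. -/
def leavesGivenRoot {S : Type} [Fintype S] (κ : S → PMF S) (d : ℕ) (x : S) :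
    (h : ℕ) → PMF (Fin (d ^ h) → S)
  | 0 => PMF.pure fun _ => x
  | h + 1 => (leavesGivenRoot κ d x h).bind fun X => independentLaw fun r => κ (X (parent d h r))

/-- The joint law of the leaves and the root in the `(d, h, κ, ν)`-broadcast process. -/
def leavesAndRoot {S : Type} [Fintype S] (κ : S → PMF S) (ν : PMF S) (d h : ℕ) :
    PMF ((Fin (d ^ h) → S) × S) :=
  ν.bind fun x => (leavesGivenRoot κ d x h).map fun X => (X, x)

/-- The `(d, h, κ, ν)`-language: the law of the leaves in the broadcast process. -/
def language {S : Type} [Fintype S] (κ : S → PMF S) (ν : PMF S) (d h : ℕ) :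
    PMF (Fin (d ^ h) → S) :=
  (leavesAndRoot κ ν d h).map Prod.fst

/-! ### The autoregressive process -/

/-- The leaves (left to right) of the `r`-th subtree of height `w` in the tree of height `h`. -/
def block {S : Type} {d h w : ℕ} (hw : w ≤ h) (X : Fin (d ^ h) → S) (r : Fin (d ^ (h - w))) :
    Fin (d ^ w) → S :=
  fun j => X ⟨r.1 * d ^ w + j.1, by
    calc (r : ℕ) * d ^ w + j < r * d ^ w + d ^ w := Nat.add_lt_add_left j.2 _
      _ = (r + 1) * d ^ w := by ring
      _ ≤ d ^ (h - w) * d ^ w := Nat.mul_le_mul_right _ r.2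
      _ = d ^ h := by rw [← pow_add, Nat.sub_add_cancel hw]⟩

/-- The height, above their common level, of the least common ancestor of the nodes `i` and `j`
of one level: the least `k` such that the `k`-th ancestors of `i` and `j` coincide. -/
def lcaHeight (d i j : ℕ) : ℕ := sInf {k | i / d ^ k = j / d ^ k}

/-- Index of the left subtree in the `i`-th pair of adjacent subtrees. -/
def leftIndex {N : ℕ} (i : Fin (N - 1)) : Fin N := ⟨i.1, by omega⟩

/-- Index of the right subtree in the `i`-th pair of adjacent subtrees. -/
def rightIndex {N : ℕ} (i : Fin (N - 1)) : Fin N := ⟨i.1 + 1, by omega⟩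

/-- The law of the height of the least common ancestor of a uniformly random pair of adjacent
nodes at level `m` of the `d`-ary tree. -/
def heightLaw (d m : ℕ) [Nonempty (Fin (d ^ m - 1))] : PMF ℕ :=
  (PMF.uniformOfFintype (Fin (d ^ m - 1))).map fun i => lcaHeight d i.1 (i.1 + 1)

/-- The joint law of `((k, Y), Y')`, where `(Y, Y')` are the leaves of a uniformly random pair of
adjacent subtrees of height `w` in a sample of the broadcast process on the tree of height `h`,
and `k` is the height of the least common ancestor of the two subtrees. -/
def adjacentPairLaw {S : Type} [Fintype S] (κ : S → PMF S) (ν : PMF S) (d h w : ℕ) (hw : w ≤ h)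
    [Nonempty (Fin (d ^ (h - w) - 1))] :
    PMF ((ℕ × (Fin (d ^ w) → S)) × (Fin (d ^ w) → S)) :=
  (PMF.uniformOfFintype (Fin (d ^ (h - w) - 1))).bind fun i =>
    (language κ ν d h).map fun X =>
      ((lcaHeight d i.1 (i.1 + 1), block hw X (leftIndex i)), block hw X (rightIndex i))

/-- The law of the next block in the autoregressive process. Without previous block, it is the law
of the leaves of a subtree of height `w` in the broadcast process. With the previous block `y`, one
first samples the height `k` and then the leaves of a subtree of height `w` in the broadcast
process, conditioned on the adjacent subtree on the left having the leaves `y` and on the least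
common ancestor being at height `k`. (If there is only one subtree, there is no such step.) -/
def nextBlock {S : Type} [Fintype S] (κ : S → PMF S) (ν : PMF S) (d h w : ℕ) [NeZero d]
    (hw : w ≤ h) : Option (Fin (d ^ w) → S) → PMF (Fin (d ^ w) → S)
  | none => (language κ ν d h).map fun X => block hw X 0
  | some y =>
    open Classical in
    if _hne : Nonempty (Fin (d ^ (h - w) - 1)) then
      (heightLaw d (h - w)).bind fun k => condLaw (adjacentPairLaw κ ν d h w hw) (k, y)
    else (language κ ν d h).map fun X => block hw X 0

/-- The law of the first `n` blocks `Y 0, …, Y (n - 1)` when each block is sampled from `next`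
given the previous one (if there is one). -/
def generate {B : Type} (next : Option B → PMF B) : (n : ℕ) → PMF (Fin n → B)
  | 0 => PMF.pure Fin.elim0
  | n + 1 => (generate next n).bind fun Y =>
      (next (if hn : 0 < n then some (Y ⟨n - 1, by omega⟩) else none)).map fun y =>
        Fin.snoc (α := fun _ => B) Y y

/-- The concatenation of `d ^ (h - w)` blocks of length `d ^ w`. -/
def concat {S : Type} {d h w : ℕ} [NeZero d] (hw : w ≤ h)
    (Y : Fin (d ^ (h - w)) → Fin (d ^ w) → S) : Fin (d ^ h) → S :=
  fun i => Y
    ⟨i.1 / d ^ w, Nat.div_lt_of_lt_mul (by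
      rw [← pow_add, Nat.add_sub_cancel' hw]; exact i.2)⟩
    ⟨i.1 % d ^ w, Nat.mod_lt _ (pow_pos (NeZero.pos d) w)⟩

/-- The law of the leaves in the `(d, h, κ)`-autoregressive broadcast process with context
depth `w`. -/
def autoregressive {S : Type} [Fintype S] (κ : S → PMF S) (ν : PMF S) (d h w : ℕ) [NeZero d]
    (hw : w ≤ h) : PMF (Fin (d ^ h) → S) :=
  (generate (nextBlock κ ν d h w hw) (d ^ (h - w))).map (concat hw)

/-! ### The Ising model; the spins `±1` are the units of `ℤ` -/

/-- The Ising channel with correlation `ρ ∈ [0, 1]`. -/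
def isingChannel (ρ : unitInterval) (σ : ℤˣ) : PMF ℤˣ :=
  PMF.ofFintype
    (fun τ => ENNReal.ofReal (if σ = τ then (1 + (ρ : ℝ)) / 2 else (1 - (ρ : ℝ)) / 2)) (by
      have h0 := ρ.2.1
      have h1 := ρ.2.2
      have key : ENNReal.ofReal ((1 + (ρ : ℝ)) / 2) + ENNReal.ofReal ((1 - (ρ : ℝ)) / 2) = 1 := by
        rw [← ENNReal.ofReal_add (by linarith) (by linarith), ← ENNReal.ofReal_one]
        congr 1
        ring
      have hu : (Finset.univ : Finset ℤˣ) = {1, -1} := rfl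
      rw [hu, Finset.sum_pair (by decide)]
      rcases Int.units_eq_one_or σ with rfl | rfl
      · rw [if_pos rfl, if_neg (by decide), key]
      · rw [if_neg (by decide), if_pos rfl, add_comm, key])

/-- The Rademacher law. -/
def rademacher : PMF ℤˣ := PMF.uniformOfFintype ℤˣ

/-- The law of the leaves of the Ising broadcast process on the `d`-ary tree of height `h`. -/
def isingLanguage (d : ℕ) (ρ : unitInterval) (h : ℕ) : PMF (Fin (d ^ h) → ℤˣ) :=
  language (isingChannel ρ) rademacher d h

/-- The law of the autoregressive Ising broadcast process with context depth `w`. -/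
def isingAutoregressive (d : ℕ) [NeZero d] (ρ : unitInterval) (h w : ℕ) (hw : w ≤ h) :
    PMF (Fin (d ^ h) → ℤˣ) :=
  autoregressive (isingChannel ρ) rademacher d h w hw

/-- The variance of the sum of the spins, for a random spin vector with law `p`. -/
def varSum {n : ℕ} (p : PMF (Fin n → ℤˣ)) : ℝ :=
  letI : MeasurableSpace (Fin n → ℤˣ) := ⊤
  ProbabilityTheory.variance (fun X => ∑ i, ((X i : ℤ) : ℝ)) p.toMeasure

/-- `E[X | Y = y]`, where `X` is the root and `Y` are the leaves of the Ising broadcast process. -/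
def rootMean (d : ℕ) (ρ : unitInterval) (h : ℕ) (y : Fin (d ^ h) → ℤˣ) : ℝ :=
  ∑ x : ℤˣ, (condLaw (leavesAndRoot (isingChannel ρ) rademacher d h) y x).toReal * ((x : ℤ) : ℝ)

/-- `q_h = E[E[X | Y]²]`, where `X` is the root and `Y` are the leaves of the Ising broadcast
process on the tree of height `h`. -/
def q (d : ℕ) (ρ : unitInterval) (h : ℕ) : ℝ :=
  ∑ y, (isingLanguage d ρ h y).toReal * rootMean d ρ h y ^ 2

/-- `q* = lim q_h` as `h → ∞`. -/
def qStar (d : ℕ) (ρ : unitInterval) : ℝ := Filter.limUnder Filter.atTop (q d ρ)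

/-- `α* = E[ρ ^ (2 s)]`, where `P(s = k) = (1 - 1 / d) * (1 / d) ^ (k - 1)` for `k = 1, 2, …`. -/
def alphaStar (d : ℕ) (ρ : unitInterval) : ℝ :=
  ∑' k : ℕ, (1 - 1 / (d : ℝ)) * (1 / (d : ℝ)) ^ k * (ρ : ℝ) ^ (2 * (k + 1))

/-- The constant `C_{d,ρ}(2)`. -/
def constC (d : ℕ) (ρ : unitInterval) : ℝ :=
  (1 - 1 / (d : ℝ)) * (d * (ρ : ℝ) ^ 2 / (d * (ρ : ℝ) ^ 2 - 1))

/-- The constant `A_{d,ρ}(2)`. -/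
def constA (d : ℕ) (ρ : unitInterval) : ℝ :=
  constC d ρ + 2 * alphaStar d ρ / (1 - alphaStar d ρ * qStar d ρ)

end Broadcast

end

open Broadcast Filter Topology

open Broadcast Filter Topology

namespace Broadcast

/-! Let `μ` be the law of the leaves of a subtree of height `w`, and `m(y)` the posterior mean of
its root (`rootMean`). A function of one sign is affine, so given the root `x` the leaves have law
`μ(y)(1 + x m(y))`. Subtrees are independent given their roots, and two roots whose common ancestor
is at height `k` have mean `0` and correlation `ρ^(2k)`; hence two such subtrees have joint law
`μ(y) μ(z) (1 + ρ^(2k) m(y) m(z))` (`expect_block_mul_block`, `adjacentPairLaw_toReal`). Averaging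
over the height, the transition of the autoregressive chain is `μ(z)(1 + a m(y) m(z))` with `a =
adjacentCorr` (`nextBlock_some_toReal`).

This is a rank-one perturbation of independent sampling: `μ` is stationary and `m` is an
eigenfunction with eigenvalue `a q`, where `q = E[m²]`. For `f` the sum of the spins of a block,
`E[f m] = (dρ)^w`, so blocks at distance `j + 1` have covariance `a (a q)^j (dρ)^(2w)`, and the
variance of the total is an explicit double geometric sum (`expect_generate_sum_sq`,
`varSum_isingAutoregressive`).

After division by `d^h (dρ²)^w`, the diagonal terms tend to `C` by solving a linear recursion in the
height (`leafVariance_eq`), and the covariances tend to `2α*/(1 - α* q*)`. For the latter, `q`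
converges because it decreases (`q_antitone`), and `a → α*` by an affine contraction
(`tendsto_sum_pow_lcaHeight`). For the true process only the diagonal analysis is needed, with `w =
h`. -/

/-! ### Expectations under discrete laws -/

/-- The expectation of a real function under a law on a finite type. -/
noncomputable def expect {α : Type} [Fintype α] (p : PMF α) (f : α → ℝ) : ℝ :=
  ∑ a, (p a).toReal * f a

section expect

variable {α β : Type} [Fintype α] [Fintype β]

lemma toReal_bind_apply {β : Type} (p : PMF α) (f : α → PMF β) (b : β) :
    ((p.bind f) b).toReal = expect p fun a => (f a b).toReal := by
  rw [PMF.bind_apply, tsum_fintype, ENNReal.toReal_sum]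
  · simp [expect, ENNReal.toReal_mul]
  · intro a _
    exact ENNReal.mul_ne_top (p.apply_ne_top a) ((f a).apply_ne_top b)

lemma toReal_map_apply {β : Type} [DecidableEq β] (p : PMF α) (f : α → β) (b : β) :
    ((p.map f) b).toReal = expect p fun a => if f a = b then 1 else 0 := by
  rw [← PMF.bind_pure_comp, toReal_bind_apply]
  congr 1
  funext a
  simp only [Function.comp, PMF.pure_apply, eq_comm]
  split_ifs <;> simp

lemma expect_bind (p : PMF α) (f : α → PMF β) (g : β → ℝ) :
    expect (p.bind f) g = expect p fun a => expect (f a) g := by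
  simp only [expect, toReal_bind_apply, Finset.sum_mul, Finset.mul_sum]
  rw [Finset.sum_comm]
  simp only [mul_assoc]

lemma expect_pure (a : α) (g : α → ℝ) : expect (PMF.pure a) g = g a := by
  classical
  rw [expect, Finset.sum_eq_single a] <;> simp +contextual [PMF.pure_apply]

lemma expect_map (p : PMF α) (f : α → β) (g : β → ℝ) :
    expect (p.map f) g = expect p fun a => g (f a) := by
  rw [← PMF.bind_pure_comp, expect_bind]
  simp [expect_pure]

lemma sum_toReal (p : PMF α) : ∑ a, (p a).toReal = 1 := by
  rw [← ENNReal.toReal_sum fun a _ => p.apply_ne_top a, ← tsum_fintype (L := .unconditional _),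
    p.tsum_coe, ENNReal.toReal_one]

lemma expect_const (p : PMF α) (c : ℝ) : (expect p fun _ => c) = c := by
  rw [expect, ← Finset.sum_mul, sum_toReal, one_mul]

lemma expect_add (p : PMF α) (f g : α → ℝ) :
    (expect p fun a => f a + g a) = expect p f + expect p g := by
  simp only [expect, mul_add, Finset.sum_add_distrib]

lemma expect_const_mul (p : PMF α) (c : ℝ) (f : α → ℝ) :
    (expect p fun a => c * f a) = c * expect p f := by
  simp only [expect, Finset.mul_sum, mul_left_comm]

lemma expect_mul_const (p : PMF α) (c : ℝ) (f : α → ℝ) :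
    (expect p fun a => f a * c) = expect p f * c := by
  simp only [expect, Finset.sum_mul, mul_assoc]

lemma expect_sum {ι : Type} (t : Finset ι) (p : PMF α) (f : ι → α → ℝ) :
    (expect p fun a => ∑ i ∈ t, f i a) = ∑ i ∈ t, expect p (f i) := by
  simp only [expect, Finset.mul_sum]
  rw [Finset.sum_comm]

lemma expect_uniform [Nonempty α] (f : α → ℝ) :
    expect (PMF.uniformOfFintype α) f = (∑ a, f a) / Fintype.card α := by
  simp [expect, PMF.uniformOfFintype_apply, ← Finset.mul_sum, div_eq_inv_mul]

lemma expect_indicator [DecidableEq α] (p : PMF α) (a : α) :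
    (expect p fun b => if b = a then 1 else 0) = (p a).toReal := by
  simp [expect]

end expect

/-! ### Independent families -/

section independent

variable {ι S : Type} [Fintype ι] [DecidableEq ι] [Fintype S]

lemma independentLaw_apply (p : ι → PMF S) (y : ι → S) :
    independentLaw p y = ∏ i, p i (y i) := rfl

lemma expect_independentLaw_prod (p : ι → PMF S) (f : ι → S → ℝ) :
    (expect (independentLaw p) fun y => ∏ i, f i (y i)) = ∏ i, expect (p i) (f i) := by
  simp only [expect, independentLaw_apply, ENNReal.toReal_prod, ← Finset.prod_mul_distrib]
  exact (Fintype.prod_sum fun i s => (p i s).toReal * f i s).symm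

lemma expect_independentLaw_eval (p : ι → PMF S) (i : ι) (f : S → ℝ) :
    (expect (independentLaw p) fun y => f (y i)) = expect (p i) f := by
  have h := expect_independentLaw_prod p fun k s => if k = i then f s else 1
  rw [Finset.prod_eq_single i] at h
  · simpa using h
  · intro k _ hk
    simp [hk, expect_const]
  · simp

lemma expect_independentLaw_eval_mul (p : ι → PMF S) {i j : ι} (hij : i ≠ j) (f g : S → ℝ) :
    (expect (independentLaw p) fun y => f (y i) * g (y j)) = expect (p i) f * expect (p j) g := by
  have h := expect_independentLaw_prod p fun k s =>
    (if k = i then f s else 1) * (if k = j then g s else 1)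
  rw [Finset.prod_eq_mul i j hij] at h
  · simpa only [Finset.prod_mul_distrib, Finset.prod_ite_eq', Finset.mem_univ, if_true, mul_one,
      one_mul, if_neg hij, if_neg hij.symm] using h
  · rintro k _ ⟨hi, hj⟩
    simp [hi, hj, expect_const]
  · simp
  · simp

lemma independentLaw_pure (a : ι → S) :
    (independentLaw fun i => PMF.pure (a i)) = PMF.pure a := by
  classical
  ext y
  rw [independentLaw_apply, PMF.pure_apply]
  simp only [PMF.pure_apply]
  rw [Fintype.prod_ite_zero]
  simp [funext_iff]

/-- Expanding a product of sums over configurations shows that coordinatewise channels preserve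
independence. This drives the induction that separates the subtrees. -/
lemma independentLaw_bind {T : Type} [Fintype T] (p : ι → PMF S) (H : S → PMF T) :
    ((independentLaw p).bind fun y => independentLaw fun i => H (y i)) =
      independentLaw fun i => (p i).bind H := by
  ext z
  simp only [PMF.bind_apply, independentLaw_apply, tsum_fintype, ← Finset.prod_mul_distrib]
  exact (Fintype.prod_sum fun i s => p i s * H s (z i)).symm

end independent

/-! ### Subtrees -/

section blocks

variable {S : Type}

/-- The node `j` of the `r`-th subtree of height `w` hanging from level `m`. -/
def leafEquiv (d m w : ℕ) : Fin (d ^ m) × Fin (d ^ w) ≃ Fin (d ^ (m + w)) :=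
  finProdFinEquiv.trans (finCongr (pow_add d m w).symm)

lemma leafEquiv_val (d m w : ℕ) (x : Fin (d ^ m) × Fin (d ^ w)) :
    (leafEquiv d m w x : ℕ) = x.2 + d ^ w * x.1 := rfl

/-- Cutting the leaves into those of the subtrees of height `w`. -/
def cut {d m w : ℕ} (X : Fin (d ^ (m + w)) → S) (r : Fin (d ^ m)) : Fin (d ^ w) → S :=
  fun j => X (leafEquiv d m w (r, j))

variable [Fintype S]

/-- Cutting only relabels coordinates, so each family of blocks has exactly one preimage and the
product regroups. -/
lemma independentLaw_map_cut {d m w : ℕ} (p : Fin (d ^ (m + w)) → PMF S) :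
    (independentLaw p).map cut =
      independentLaw fun r => independentLaw fun j => p (leafEquiv d m w (r, j)) := by
  ext B
  have hB : B = cut (fun i => B ((leafEquiv d m w).symm i).1 ((leafEquiv d m w).symm i).2) := by
    funext r j
    simp [cut]
  have hinj : Function.Injective (cut : (Fin (d ^ (m + w)) → S) → _) := by
    intro X X' h
    funext i
    have := congrFun (congrFun h ((leafEquiv d m w).symm i).1) ((leafEquiv d m w).symm i).2
    simpa [cut] using this
  conv_lhs => rw [hB]
  rw [PMF.map_apply, tsum_eq_single _ (fun X hX => if_neg fun h => hX (hinj h).symm), if_pos rfl]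
  simp only [independentLaw_apply]
  rw [← (leafEquiv d m w).prod_comp, Fintype.prod_prod_type]
  simp

/-- Given the values at level `m`, the subtrees hanging from level `m` are independent. -/
lemma leavesGivenRoot_map_cut (κ : S → PMF S) (d : ℕ) (x : S) (m w : ℕ) :
    (leavesGivenRoot κ d x (m + w)).map cut =
      (leavesGivenRoot κ d x m).bind fun Z =>
        independentLaw fun r => leavesGivenRoot κ d (Z r) w := by
  induction w with
  | zero =>
    simp only [leavesGivenRoot, independentLaw_pure]
    rw [← PMF.bind_pure_comp]
    congr 1
    funext X
    simp only [Function.comp]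
    congr 1
    funext r j
    simp only [cut]
    congr 1
    apply Fin.ext
    have := j.2
    simp only [leafEquiv_val, pow_zero] at this ⊢
    omega
  | succ w ih =>
    -- One broadcast step inside a single subtree. It commutes with cutting, because the parent of
    -- node `j` of subtree `r` is the node `parent j` of the same subtree.
    let H : (Fin (d ^ w) → S) → PMF (Fin (d ^ (w + 1)) → S) := fun b =>
      independentLaw fun j => κ (b (parent d w j))
    have h1 : ∀ X : Fin (d ^ (m + w)) → S,
        (independentLaw fun r : Fin (d ^ (m + w + 1)) => κ (X (parent d (m + w) r))).map
          (cut (w := w + 1)) = independentLaw fun r => H (cut X r) := by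
      intro X
      refine (independentLaw_map_cut (m := m) (w := w + 1) _).trans ?_
      congr 1
      funext r
      congr 1
      funext j
      congr 2
      apply Fin.ext
      change (j.1 + d ^ (w + 1) * r.1) / d = j.1 / d + d ^ w * r.1
      have hd : 0 < d := by
        rcases Nat.eq_zero_or_pos d with rfl | h
        · exact absurd j.2 (by simp)
        · exact h
      rw [show j.1 + d ^ (w + 1) * r.1 = j.1 + d ^ w * r.1 * d by ring,
        Nat.add_mul_div_right _ _ hd]
    calc (leavesGivenRoot κ d x (m + (w + 1))).map cut
        = (leavesGivenRoot κ d x (m + w)).bind fun X => independentLaw fun r => H (cut X r) := by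
          change PMF.map _ (PMF.bind _ _) = _
          rw [PMF.map_bind]
          congr 1
          funext X
          exact h1 X
      _ = ((leavesGivenRoot κ d x (m + w)).map cut).bind fun B => independentLaw fun r => H (B r) := by
          rw [PMF.bind_map]; rfl
      _ = _ := by
          rw [ih, PMF.bind_bind]
          congr 1
          funext Z
          rw [independentLaw_bind]
          rfl

end blocks

/-! ### Heights of least common ancestors -/

lemma lcaHeight_self (d i : ℕ) : lcaHeight d i i = 0 := by
  simp [lcaHeight]

lemma lcaHeight_of_ne {d i j : ℕ} (hd : 1 < d) (hij : i ≠ j) :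
    lcaHeight d i j = lcaHeight d (i / d) (j / d) + 1 := by
  have hne : {k | i / d ^ k = j / d ^ k}.Nonempty := by
    -- Since `d ^ (i + j)` exceeds both indices, both quotients are `0`. Nonemptiness matters
    -- because `sInf ∅ = 0`.
    refine ⟨i + j, ?_⟩
    have hlt : i + j < d ^ (i + j) := Nat.lt_pow_self hd
    change i / _ = j / _
    rw [Nat.div_eq_of_lt (by omega), Nat.div_eq_of_lt (by omega)]
  have h1 : 1 ≤ sInf {k | i / d ^ k = j / d ^ k} := by
    rw [Nat.one_le_iff_ne_zero]
    intro h0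
    have := Nat.sInf_mem hne
    rw [h0] at this
    exact hij (by simpa using this)
  have := Nat.sInf_add (p := fun k => i / d ^ k = j / d ^ k) h1
  rw [lcaHeight, ← this, lcaHeight]
  simp only [Nat.div_div_eq_div_mul, pow_succ']

/-! ### Spins -/

section ising

lemma sum_units (f : ℤˣ → ℝ) : ∑ x, f x = f 1 + f (-1) :=
  Finset.sum_pair (by decide)

lemma spin_mul_self (x : ℤˣ) : ((x : ℤ) : ℝ) * ((x : ℤ) : ℝ) = 1 := by
  rcases Int.units_eq_one_or x with rfl | rfl <;> simp

variable (d : ℕ) (ρ : unitInterval)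

lemma isingChannel_toReal (σ τ : ℤˣ) :
    (isingChannel ρ σ τ).toReal = (1 + ρ * ((σ : ℤ) : ℝ) * ((τ : ℤ) : ℝ)) / 2 := by
  have h0 := ρ.2.1
  have h1 := ρ.2.2
  change (ENNReal.ofReal _).toReal = _
  rw [ENNReal.toReal_ofReal (by split_ifs <;> linarith)]
  rcases Int.units_eq_one_or σ with rfl | rfl <;> rcases Int.units_eq_one_or τ with rfl | rfl <;>
    simp [show (1 : ℤˣ) ≠ -1 by decide, show (-1 : ℤˣ) ≠ 1 by decide] <;> ring

lemma expect_isingChannel (σ : ℤˣ) :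
    (expect (isingChannel ρ σ) fun τ => ((τ : ℤ) : ℝ)) = ρ * ((σ : ℤ) : ℝ) := by
  simp only [expect, isingChannel_toReal, sum_units]
  simp
  ring

lemma expect_rademacher (f : ℤˣ → ℝ) : expect rademacher f = (f 1 + f (-1)) / 2 := by
  rw [rademacher, expect_uniform, sum_units]
  simp

/-- The leaves of the Ising broadcast process, given the root. -/
noncomputable abbrev isingGivenRoot (x : ℤˣ) (h : ℕ) : PMF (Fin (d ^ h) → ℤˣ) :=
  leavesGivenRoot (isingChannel ρ) d x h

lemma language_eq_bind {S : Type} [Fintype S] (κ : S → PMF S) (ν : PMF S) (d h : ℕ) :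
    language κ ν d h = ν.bind fun x => leavesGivenRoot κ d x h := by
  rw [language, leavesAndRoot, PMF.map_bind]
  congr 1
  funext x
  rw [PMF.map_comp]
  exact PMF.map_id _

lemma expect_isingLanguage (h : ℕ) (f : (Fin (d ^ h) → ℤˣ) → ℝ) :
    expect (isingLanguage d ρ h) f =
      (expect (isingGivenRoot d ρ 1 h) f + expect (isingGivenRoot d ρ (-1) h) f) / 2 := by
  rw [isingLanguage, language_eq_bind, expect_bind, expect_rademacher]

/-- The expectation of the root times the indicator of the leaves `y`. -/
noncomputable def rootBias (h : ℕ) (y : Fin (d ^ h) → ℤˣ) : ℝ :=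
  ((isingGivenRoot d ρ 1 h y).toReal - (isingGivenRoot d ρ (-1) h y).toReal) / 2

lemma isingLanguage_toReal (h : ℕ) (y : Fin (d ^ h) → ℤˣ) :
    (isingLanguage d ρ h y).toReal =
      ((isingGivenRoot d ρ 1 h y).toReal + (isingGivenRoot d ρ (-1) h y).toReal) / 2 := by
  classical
  have := expect_isingLanguage d ρ h fun b => if b = y then 1 else 0
  simpa only [expect_indicator] using this

/-- Every function of a sign is affine: its mean plus the sign times half the difference of its two
values. -/
lemma isingGivenRoot_toReal (x : ℤˣ) (h : ℕ) (y : Fin (d ^ h) → ℤˣ) :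
    (isingGivenRoot d ρ x h y).toReal =
      (isingLanguage d ρ h y).toReal + ((x : ℤ) : ℝ) * rootBias d ρ h y := by
  rw [isingLanguage_toReal, rootBias]
  rcases Int.units_eq_one_or x with rfl | rfl <;> push_cast <;> ring

lemma expect_isingGivenRoot (x : ℤˣ) (h : ℕ) (f : (Fin (d ^ h) → ℤˣ) → ℝ) :
    expect (isingGivenRoot d ρ x h) f =
      expect (isingLanguage d ρ h) f + ((x : ℤ) : ℝ) * ∑ y, rootBias d ρ h y * f y := by
  simp only [expect, isingGivenRoot_toReal, add_mul, Finset.sum_add_distrib, Finset.mul_sum,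
    mul_assoc]

lemma sum_rootBias_mul (h : ℕ) (f : (Fin (d ^ h) → ℤˣ) → ℝ) :
    ∑ y, rootBias d ρ h y * f y =
      (expect (isingGivenRoot d ρ 1 h) f - expect (isingGivenRoot d ρ (-1) h) f) / 2 := by
  rw [expect_isingGivenRoot, expect_isingGivenRoot]
  push_cast
  ring

lemma sum_rootBias (h : ℕ) : ∑ y, rootBias d ρ h y = 0 := by
  have := sum_rootBias_mul d ρ h fun _ => 1
  simpa [expect_const] using this

lemma abs_rootBias_le (h : ℕ) (y : Fin (d ^ h) → ℤˣ) :
    |rootBias d ρ h y| ≤ (isingLanguage d ρ h y).toReal := by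
  rw [isingLanguage_toReal, rootBias, abs_le]
  have h1 : 0 ≤ (isingGivenRoot d ρ 1 h y).toReal := ENNReal.toReal_nonneg
  have h2 : 0 ≤ (isingGivenRoot d ρ (-1) h y).toReal := ENNReal.toReal_nonneg
  constructor <;> linarith

/-! ### Conditional laws -/

lemma condLaw_toReal {α β : Type} [Fintype β] (p : PMF (α × β)) (a : α)
    (h : ∑ b, (p (a, b)).toReal ≠ 0) (b : β) :
    (condLaw p a b).toReal = (p (a, b)).toReal / ∑ b, (p (a, b)).toReal := by
  have hs : (∑' b, p (a, b)).toReal = ∑ b, (p (a, b)).toReal := by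
    rw [tsum_fintype, ENNReal.toReal_sum fun _ _ => p.apply_ne_top _]
  have h' : (∑' b, p (a, b)) ≠ 0 := by
    intro h0
    rw [← hs, h0] at h
    simp at h
  rw [condLaw, dif_pos h', PMF.normalize_apply, ENNReal.toReal_mul, ENNReal.toReal_inv, hs,
    div_eq_mul_inv]

lemma leavesAndRoot_toReal (h : ℕ) (y : Fin (d ^ h) → ℤˣ) (x : ℤˣ) :
    (leavesAndRoot (isingChannel ρ) rademacher d h (y, x)).toReal =
      (isingGivenRoot d ρ x h y).toReal / 2 := by
  classical
  rw [leavesAndRoot, toReal_bind_apply, expect_rademacher]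
  simp only [toReal_map_apply, Prod.mk.injEq]
  rcases Int.units_eq_one_or x with rfl | rfl <;>
    simp [expect_indicator, expect_const, show (1 : ℤˣ) ≠ -1 by decide,
      show (-1 : ℤˣ) ≠ 1 by decide]

/-- Bayes' formula, multiplied out so that it also covers null configurations: there `rootBias`
vanishes by domination, whatever default value `condLaw` takes. -/
lemma isingLanguage_mul_rootMean (h : ℕ) (y : Fin (d ^ h) → ℤˣ) :
    (isingLanguage d ρ h y).toReal * rootMean d ρ h y = rootBias d ρ h y := by
  by_cases h0 : (isingLanguage d ρ h y).toReal = 0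
  · have := abs_rootBias_le d ρ h y
    rw [h0] at this ⊢
    rw [zero_mul, abs_nonpos_iff.mp this]
  · have hs : ∑ x, (leavesAndRoot (isingChannel ρ) rademacher d h (y, x)).toReal =
        (isingLanguage d ρ h y).toReal := by
      simp only [leavesAndRoot_toReal, sum_units, isingLanguage_toReal]
      ring
    have hne := h0
    rw [← hs] at hne
    simp only [rootMean, condLaw_toReal _ _ hne, hs]
    simp only [sum_units, leavesAndRoot_toReal, rootBias]
    field_simp
    push_cast
    ring

lemma sum_rootBias_mul_rootMean (h : ℕ) :
    ∑ y, rootBias d ρ h y * rootMean d ρ h y = q d ρ h := by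
  simp only [q, ← isingLanguage_mul_rootMean, sq, mul_assoc]

lemma expect_mul_rootMean (h : ℕ) (f : (Fin (d ^ h) → ℤˣ) → ℝ) :
    (expect (isingLanguage d ρ h) fun y => f y * rootMean d ρ h y) =
      ∑ y, rootBias d ρ h y * f y := by
  simp only [expect, ← isingLanguage_mul_rootMean]
  refine Finset.sum_congr rfl fun y _ => ?_
  ring

lemma expect_rootMean (h : ℕ) : expect (isingLanguage d ρ h) (rootMean d ρ h) = 0 := by
  have := expect_mul_rootMean d ρ h fun _ => 1
  simpa [sum_rootBias] using this

/-! ### Moments of the spins -/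

lemma parent_finProdFinEquiv (h : ℕ) (x : Fin (d ^ h) × Fin d) :
    parent d h (finProdFinEquiv x) = x.1 := by
  apply Fin.ext
  change (x.2.1 + d * x.1.1) / d = x.1.1
  rw [Nat.add_mul_div_left _ _ x.2.pos, Nat.div_eq_of_lt x.2.2, zero_add]

lemma sum_parent (h : ℕ) (f : Fin (d ^ h) → ℝ) :
    ∑ r, f (parent d h r) = d * ∑ r, f r := by
  refine ((finProdFinEquiv (m := d ^ h) (n := d)).sum_comp fun r => f (parent d h r)).symm.trans ?_
  rw [Fintype.sum_prod_type]
  refine (Finset.sum_congr rfl fun x _ => Finset.sum_congr rfl fun j _ =>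
    congrArg f (parent_finProdFinEquiv d h (x, j))).trans ?_
  simp [Finset.mul_sum]

lemma expect_children_mul {h : ℕ} (X : Fin (d ^ h) → ℤˣ) (r s : Fin (d ^ (h + 1))) :
    (expect (independentLaw fun r => isingChannel ρ (X (parent d h r)))
      fun y => ((y r : ℤ) : ℝ) * ((y s : ℤ) : ℝ)) =
      if r = s then 1 else ρ ^ 2 * (((X (parent d h r) : ℤ) : ℝ) * ((X (parent d h s) : ℤ) : ℝ)) := by
  split_ifs with hrs
  · subst hrs
    simp only [spin_mul_self, expect_const]
  · rw [expect_independentLaw_eval_mul _ hrs (fun τ : ℤˣ => ((τ : ℤ) : ℝ))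
      (fun τ : ℤˣ => ((τ : ℤ) : ℝ)),
      expect_isingChannel, expect_isingChannel]
    ring

lemma expect_spin (x : ℤˣ) (h : ℕ) (r : Fin (d ^ h)) :
    (expect (isingGivenRoot d ρ x h) fun X => ((X r : ℤ) : ℝ)) = ρ ^ h * ((x : ℤ) : ℝ) := by
  induction h with
  | zero => exact (expect_pure _ _).trans (by simp)
  | succ h ih =>
    rw [isingGivenRoot, leavesGivenRoot, expect_bind]
    have : ∀ X : Fin (d ^ h) → ℤˣ,
        (expect (independentLaw fun r => isingChannel ρ (X (parent d h r)))
          fun y => ((y r : ℤ) : ℝ)) = ρ * ((X (parent d h r) : ℤ) : ℝ) := fun X => by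
      rw [expect_independentLaw_eval _ r fun τ : ℤˣ => ((τ : ℤ) : ℝ), expect_isingChannel]
    simp only [this, expect_const_mul]
    rw [ih]
    ring

/-- Distinct spins are independent given their parents, so going up one level costs a factor `ρ²`
and lowers the common ancestor height by one. Once the two ancestors agree, the product of the spins
is `1`. -/
lemma expect_spin_mul_spin (hd : 1 < d) (x : ℤˣ) (h : ℕ) (r s : Fin (d ^ h)) :
    (expect (isingGivenRoot d ρ x h) fun X => ((X r : ℤ) : ℝ) * ((X s : ℤ) : ℝ)) =
      ((ρ : ℝ) ^ 2) ^ lcaHeight d r s := by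
  induction h with
  | zero =>
    have : r = s := Fin.ext (by have := r.2; have := s.2; simp at *; omega)
    subst this
    simp only [spin_mul_self, expect_const, lcaHeight_self, pow_zero]
  | succ h ih =>
    rw [isingGivenRoot, leavesGivenRoot, expect_bind]
    simp only [expect_children_mul]
    split_ifs with hrs
    · subst hrs
      simp only [expect_const, lcaHeight_self, pow_zero]
    · rw [expect_const_mul, ih, lcaHeight_of_ne hd fun hv => hrs (Fin.ext hv),
        pow_succ' ((ρ : ℝ) ^ 2)]
      rfl

lemma expect_sum_spin (x : ℤˣ) (h : ℕ) :
    (expect (isingGivenRoot d ρ x h) fun X => ∑ r, ((X r : ℤ) : ℝ)) =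
      (d * ρ) ^ h * ((x : ℤ) : ℝ) := by
  rw [expect_sum]
  simp only [expect_spin]
  simp [mul_pow]
  ring

lemma expect_language_sum_spin (h : ℕ) :
    (expect (isingLanguage d ρ h) fun X => ∑ r, ((X r : ℤ) : ℝ)) = 0 := by
  rw [expect_isingLanguage, expect_sum_spin, expect_sum_spin]
  push_cast
  ring

lemma sum_rootBias_mul_sum_spin (h : ℕ) :
    ∑ y, rootBias d ρ h y * ∑ r, ((y r : ℤ) : ℝ) = (d * ρ) ^ h := by
  rw [sum_rootBias_mul, expect_sum_spin, expect_sum_spin]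
  push_cast
  ring

/-- The second moment of the sum of the leaves of the broadcast process. -/
noncomputable def leafVariance (h : ℕ) : ℝ :=
  expect (isingLanguage d ρ h) fun X => (∑ r, ((X r : ℤ) : ℝ)) ^ 2

lemma leafVariance_zero : leafVariance d ρ 0 = 1 := by
  have h (x : ℤˣ) : (expect (isingGivenRoot d ρ x 0) fun X => (∑ r, ((X r : ℤ) : ℝ)) ^ 2) = 1 := by
    refine (expect_pure _ _).trans ?_
    change (∑ _r : Fin 1, ((x : ℤ) : ℝ)) ^ 2 = 1
    simp [sq, spin_mul_self]
  rw [leafVariance, expect_isingLanguage, h, h]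
  norm_num

/-- The off-diagonal formula is used for all pairs, with a correction `1 - ρ²` on each of the `d ^
(h + 1)` diagonal ones; each parent is then counted `d` times. -/
lemma expect_children_sum_sq {h : ℕ} (X : Fin (d ^ h) → ℤˣ) :
    (expect (independentLaw fun r => isingChannel ρ (X (parent d h r)))
      fun y => (∑ r, ((y r : ℤ) : ℝ)) ^ 2) =
      (d * ρ) ^ 2 * (∑ r, ((X r : ℤ) : ℝ)) ^ 2 + d ^ (h + 1) * (1 - ρ ^ 2) := by
  have h1 : ∀ r s : Fin (d ^ (h + 1)),
      (expect (independentLaw fun r => isingChannel ρ (X (parent d h r)))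
        fun y => ((y r : ℤ) : ℝ) * ((y s : ℤ) : ℝ)) =
      ρ ^ 2 * (((X (parent d h r) : ℤ) : ℝ) * ((X (parent d h s) : ℤ) : ℝ)) +
        if r = s then 1 - (ρ : ℝ) ^ 2 else 0 := by
    intro r s
    rw [expect_children_mul]
    split_ifs with hrs
    · subst hrs
      rw [spin_mul_self]
      ring
    · ring
  simp only [sq (∑ r, _), Finset.sum_mul_sum, expect_sum, h1, Finset.sum_add_distrib]
  simp only [← Finset.mul_sum, ← Finset.sum_mul]
  rw [sum_parent d h fun r => ((X r : ℤ) : ℝ)]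
  simp
  ring

lemma leafVariance_succ (h : ℕ) :
    leafVariance d ρ (h + 1) =
      (d * ρ) ^ 2 * leafVariance d ρ h + d ^ (h + 1) * (1 - ρ ^ 2) := by
  simp only [leafVariance, isingLanguage, language_eq_bind, leavesGivenRoot, ← PMF.bind_bind]
  rw [expect_bind]
  simp only [expect_children_sum_sq, expect_add, expect_const_mul, expect_const]

/-- Without degenerate transitions, every configuration of the leaves has positive probability. -/
lemma isingLanguage_pos (h1 : (ρ : ℝ) < 1) (h : ℕ) (y : Fin (d ^ h) → ℤˣ) :
    0 < (isingLanguage d ρ h y).toReal := by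
  have h0 := ρ.2.1
  cases h with
  | zero =>
    rw [isingLanguage_toReal]
    have : ∀ x, (isingGivenRoot d ρ x 0 y).toReal = if y 0 = x then 1 else 0 := by
      intro x
      have hy : (y = fun _ => x) ↔ y 0 = x :=
        ⟨fun hh => by rw [hh], fun hh => funext fun r => by
          rw [← hh]
          congr 1
          exact (Subsingleton.elim (α := Fin 1) r 0)⟩
      simp only [isingGivenRoot, leavesGivenRoot, PMF.pure_apply, hy]
      split_ifs <;> simp
    rw [this, this]
    rcases Int.units_eq_one_or (y 0) with hy | hy <;> simp [hy, show (1 : ℤˣ) ≠ -1 by decide,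
      show (-1 : ℤˣ) ≠ 1 by decide]
  | succ h =>
    rw [isingLanguage, language_eq_bind]
    simp only [leavesGivenRoot, ← PMF.bind_bind]
    set p := rademacher.bind fun x => leavesGivenRoot (isingChannel ρ) d x h
    have hpos : ∀ X : Fin (d ^ h) → ℤˣ,
        0 < (independentLaw (fun r => isingChannel ρ (X (parent d h r))) y).toReal := by
      intro X
      rw [independentLaw_apply, ENNReal.toReal_prod]
      refine Finset.prod_pos fun r _ => ?_
      rw [isingChannel_toReal]
      rcases Int.units_eq_one_or (X (parent d h r)) with hX | hX <;>
        rcases Int.units_eq_one_or (y r) with hy | hy <;> rw [hX, hy] <;> push_cast <;> linarith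
    rw [toReal_bind_apply]
    -- Every transition to `y` has positive probability, so a single configuration of positive mass
    -- one level up suffices.
    obtain ⟨X, hX⟩ := p.support_nonempty
    refine Finset.sum_pos' (fun X _ => mul_nonneg ENNReal.toReal_nonneg (hpos X).le)
      ⟨X, Finset.mem_univ X, mul_pos ?_ (hpos X)⟩
    exact ENNReal.toReal_pos hX (p.apply_ne_top X)

/-! ### Monotonicity of `q` -/

/-- The form to which Cauchy–Schwarz applies; null configurations contribute `0` by the convention
for division by zero. -/
lemma q_eq_sum (h : ℕ) :
    q d ρ h = ∑ y, rootBias d ρ h y ^ 2 / (isingLanguage d ρ h y).toReal := by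
  rw [q]
  refine Finset.sum_congr rfl fun y _ => ?_
  rw [← isingLanguage_mul_rootMean]
  by_cases h0 : (isingLanguage d ρ h y).toReal = 0
  · simp [h0]
  · field_simp

lemma q_nonneg (h : ℕ) : 0 ≤ q d ρ h :=
  Finset.sum_nonneg fun _ _ => mul_nonneg ENNReal.toReal_nonneg (sq_nonneg _)

lemma q_le_one (h : ℕ) : q d ρ h ≤ 1 := by
  rw [q_eq_sum, ← sum_toReal (isingLanguage d ρ h)]
  refine Finset.sum_le_sum fun y _ => div_le_of_le_mul₀ ENNReal.toReal_nonneg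
    ENNReal.toReal_nonneg ?_
  rw [← sq_abs, ← sq]
  exact pow_le_pow_left₀ (abs_nonneg _) (abs_rootBias_le d ρ h y) 2

/-- Data processing: level `h + 1` arises from level `h` through a kernel `K` that does not see the
root, and `s² / μ` is jointly convex. Concretely, `(∑ s K)² ≤ (∑ (s² / μ) K) (∑ μ K)`, summed over
the target. -/
lemma q_antitone : Antitone (q d ρ) := by
  refine antitone_nat_of_succ_le fun h => ?_
  set K : (Fin (d ^ h) → ℤˣ) → PMF (Fin (d ^ (h + 1)) → ℤˣ) := fun X =>
    independentLaw fun r => isingChannel ρ (X (parent d h r)) with hK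
  have hroot : ∀ x z, (isingGivenRoot d ρ x (h + 1) z).toReal =
      ∑ y, (isingGivenRoot d ρ x h y).toReal * (K y z).toReal := fun x z => by
    rw [isingGivenRoot, leavesGivenRoot, toReal_bind_apply]
    rfl
  have hmu : ∀ z, (isingLanguage d ρ (h + 1) z).toReal =
      ∑ y, (isingLanguage d ρ h y).toReal * (K y z).toReal := fun z => by
    simp only [isingLanguage_toReal, hroot, ← Finset.sum_add_distrib, Finset.sum_div]
    refine Finset.sum_congr rfl fun y _ => by ring
  have hs : ∀ z, rootBias d ρ (h + 1) z = ∑ y, rootBias d ρ h y * (K y z).toReal := fun z => by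
    simp only [rootBias, hroot, ← Finset.sum_sub_distrib, Finset.sum_div]
    refine Finset.sum_congr rfl fun y _ => by ring
  have hz : ∀ z, rootBias d ρ (h + 1) z ^ 2 / (isingLanguage d ρ (h + 1) z).toReal ≤
      ∑ y, rootBias d ρ h y ^ 2 / (isingLanguage d ρ h y).toReal * (K y z).toReal := fun z => by
    refine div_le_of_le_mul₀ ENNReal.toReal_nonneg (Finset.sum_nonneg fun y _ => by positivity) ?_
    rw [hs, hmu]
    refine Finset.sum_sq_le_sum_mul_sum_of_sq_le_mul _ (fun y _ => by positivity)
      (fun y _ => by positivity) fun y _ => le_of_eq ?_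
    by_cases h0 : (isingLanguage d ρ h y).toReal = 0
    · have := abs_rootBias_le d ρ h y
      rw [h0] at this ⊢
      rw [abs_nonpos_iff.mp this]
      simp
    · field_simp
  rw [q_eq_sum, q_eq_sum]
  refine (Finset.sum_le_sum fun z _ => hz z).trans_eq ?_
  rw [Finset.sum_comm]
  simp only [← Finset.mul_sum, sum_toReal, mul_one]

lemma tendsto_q : Tendsto (q d ρ) atTop (𝓝 (qStar d ρ)) :=
  tendsto_nhds_limUnder ⟨_, tendsto_atTop_ciInf (q_antitone d ρ)
    ⟨0, by rintro _ ⟨h, rfl⟩; exact q_nonneg d ρ h⟩⟩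

end ising

/-! ### Chains of blocks -/

section chain

variable {B : Type} [Fintype B] (next : Option B → PMF B)

lemma expect_generate_one (F : (Fin 1 → B) → ℝ) :
    expect (generate next 1) F = expect (next none) fun y => F fun _ => y := by
  rw [generate, generate, PMF.pure_bind, expect_map]
  simp only [lt_irrefl, dite_false]
  rfl

lemma expect_generate_succ (k : ℕ) (F : (Fin (k + 2) → B) → ℝ) :
    expect (generate next (k + 2)) F =
      expect (generate next (k + 1)) fun Y =>
        expect (next (some (Y (Fin.last k)))) fun y => F (Fin.snoc (α := fun _ => B) Y y) := by
  rw [generate, expect_bind]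
  congr 1
  funext Y
  rw [expect_map, dif_pos k.succ_pos]
  rfl

variable {next} {μ : PMF B} {m : B → ℝ} {f : B → ℝ} {a : ℝ}

/-- The rank-one kernel acts on functions: the previous block enters only through `m y`. In
particular `m` is an eigenfunction once it is centered under `μ`. -/
lemma expect_next_some
    (hsome : ∀ y z, (next (some y) z).toReal = (μ z).toReal + a * m y * ((μ z).toReal * m z))
    (y : B) (g : B → ℝ) :
    expect (next (some y)) g = expect μ g + a * m y * expect μ fun z => g z * m z := by
  simp only [expect, hsome, Finset.mul_sum, ← Finset.sum_add_distrib]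
  refine Finset.sum_congr rfl fun z _ => ?_
  ring

lemma expect_next_none (hnone : ∀ y, (next none y).toReal = (μ y).toReal)
    (g : B → ℝ) : expect (next none) g = expect μ g := by
  simp only [expect, hnone]

/-- Stationarity of `μ`: the perturbation of the kernel integrates to zero because `m` is centered.
-/
lemma expect_generate_last
    (hnone : ∀ y, (next none y).toReal = (μ y).toReal)
    (hsome : ∀ y z, (next (some y) z).toReal = (μ z).toReal + a * m y * ((μ z).toReal * m z))
    (hm : expect μ m = 0)
    (k : ℕ) (g : B → ℝ) :
    (expect (generate next (k + 1)) fun Y => g (Y (Fin.last k))) = expect μ g := by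
  induction k generalizing g with
  | zero => rw [expect_generate_one, ← expect_next_none hnone]
  | succ k ih =>
    rw [expect_generate_succ]
    simp only [Fin.snoc_last, expect_next_some hsome, expect_add, expect_const]
    rw [expect_mul_const, expect_const_mul, ih, hm]
    ring

lemma expect_generate_sum
    (hnone : ∀ y, (next none y).toReal = (μ y).toReal)
    (hsome : ∀ y z, (next (some y) z).toReal = (μ z).toReal + a * m y * ((μ z).toReal * m z))
    (hm : expect μ m = 0) (hf : expect μ f = 0)
    (k : ℕ) :
    (expect (generate next (k + 1)) fun Y => ∑ r, f (Y r)) = 0 := by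
  induction k with
  | zero =>
    rw [expect_generate_one]
    rw [expect_next_none hnone, ← hf]
    congr 1
    funext y
    exact Fin.sum_univ_one fun _ => f y
  | succ k ih =>
    rw [expect_generate_succ]
    simp only [Fin.sum_univ_castSucc (n := k + 1), Fin.snoc_last, Fin.snoc_castSucc, expect_add,
      expect_const, ih]
    simp only [expect_next_some hsome, hf, expect_add, expect_const]
    rw [expect_mul_const, expect_const_mul,
      expect_generate_last hnone hsome hm k m, hm]
    ring

/-- With `c = E[f m]`, the eigenfunction property gives the recursion `u ↦ c + (a E[m²]) u`, whose
solution is `c` times a geometric sum. -/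
lemma expect_generate_sum_mul_last
    (hnone : ∀ y, (next none y).toReal = (μ y).toReal)
    (hsome : ∀ y z, (next (some y) z).toReal = (μ z).toReal + a * m y * ((μ z).toReal * m z))
    (hm : expect μ m = 0)
    (k : ℕ) :
    (expect (generate next (k + 1)) fun Y => (∑ r, f (Y r)) * m (Y (Fin.last k))) =
      (expect μ fun y => f y * m y) *
        ∑ j ∈ Finset.range (k + 1), (a * expect μ fun y => m y * m y) ^ j := by
  induction k with
  | zero =>
    rw [expect_generate_one, expect_next_none hnone]
    simp
  | succ k ih =>
    rw [expect_generate_succ, geom_sum_succ]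
    simp only [Fin.sum_univ_castSucc (n := k + 1), Fin.snoc_last, Fin.snoc_castSucc, add_mul,
      expect_add, expect_const_mul]
    rw [expect_generate_last hnone hsome hm k fun b => expect (next (some b)) fun y => f y * m y]
    simp only [expect_next_some hsome, hm, expect_add, expect_const, zero_add]
    rw [expect_mul_const, expect_const_mul, hm]
    have h1 : (expect (generate next (k + 1)) fun Y =>
        (∑ r, f (Y r)) * (a * m (Y (Fin.last k)) * expect μ fun y => m y * m y)) =
        expect (generate next (k + 1)) fun Y =>
          (a * expect μ fun y => m y * m y) * ((∑ r, f (Y r)) * m (Y (Fin.last k))) := by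
      congr 1
      funext Y
      ring
    rw [h1, expect_const_mul, ih]
    ring

/-- Appending a block adds `E[f²]` and twice the correlation of the old sum with the new block; the
latter is `a E[f m]` times the quantity in `expect_generate_sum_mul_last`. -/
lemma expect_generate_sum_sq
    (hnone : ∀ y, (next none y).toReal = (μ y).toReal)
    (hsome : ∀ y z, (next (some y) z).toReal = (μ z).toReal + a * m y * ((μ z).toReal * m z))
    (hm : expect μ m = 0) (hf : expect μ f = 0)
    (n : ℕ) :
    (expect (generate next n) fun Y => (∑ r, f (Y r)) ^ 2) =
      n * (expect μ fun y => f y ^ 2) + 2 * a * (expect μ fun y => f y * m y) ^ 2 *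
        ∑ i ∈ Finset.range (n - 1),
          ∑ j ∈ Finset.range (i + 1), (a * expect μ fun y => m y * m y) ^ j := by
  -- For `n = 0` truncated subtraction makes the outer sum empty, so both sides vanish.
  obtain _ | k := n
  · refine (expect_pure _ _).trans ?_
    simp
  simp only [Nat.add_sub_cancel]
  induction k with
  | zero =>
    rw [expect_generate_one, expect_next_none hnone]
    simp
  | succ k ih =>
    rw [expect_generate_succ, Finset.sum_range_succ]
    simp only [Fin.sum_univ_castSucc (n := k + 1), Fin.snoc_last, Fin.snoc_castSucc, add_sq,
      expect_add, expect_const_mul, expect_const]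
    rw [expect_generate_last hnone hsome hm k fun b => expect (next (some b)) fun y => f y ^ 2, ih]
    simp only [expect_next_some hsome, hf, expect_add, expect_const, zero_add]
    rw [expect_mul_const, expect_const_mul, hm]
    have h1 : (expect (generate next (k + 1)) fun Y =>
        2 * (∑ r, f (Y r)) * (a * m (Y (Fin.last k)) * expect μ fun y => f y * m y)) =
        expect (generate next (k + 1)) fun Y =>
          (2 * a * expect μ fun y => f y * m y) * ((∑ r, f (Y r)) * m (Y (Fin.last k))) := by
      congr 1
      funext Y
      ring
    rw [h1, expect_const_mul, expect_generate_sum_mul_last hnone hsome hm]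
    push_cast
    ring

end chain

/-! ### Adjacent blocks -/

section adjacent

variable (d : ℕ) (ρ : unitInterval)

lemma expect_language_spin (h : ℕ) (r : Fin (d ^ h)) :
    (expect (isingLanguage d ρ h) fun X => ((X r : ℤ) : ℝ)) = 0 := by
  rw [expect_isingLanguage, expect_spin, expect_spin]
  push_cast
  ring

lemma expect_language_spin_mul_spin (hd : 1 < d) (h : ℕ) (r s : Fin (d ^ h)) :
    (expect (isingLanguage d ρ h) fun X => ((X r : ℤ) : ℝ) * ((X s : ℤ) : ℝ)) =
      ((ρ : ℝ) ^ 2) ^ lcaHeight d r s := by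
  rw [expect_isingLanguage, expect_spin_mul_spin d ρ hd, expect_spin_mul_spin d ρ hd]
  ring

/-- The total height is a variable tied by `e`, so substitution removes the cast between `d ^ (h - w
+ w)` and `d ^ h`. -/
lemma isingLanguage_map_subtrees {m w h : ℕ} (e : m + w = h) :
    ((isingLanguage d ρ h).map fun X (r : Fin (d ^ m)) (j : Fin (d ^ w)) =>
        X (finCongr (congrArg (d ^ ·) e) (leafEquiv d m w (r, j)))) =
      (isingLanguage d ρ m).bind fun Z => independentLaw fun r => isingGivenRoot d ρ (Z r) w := by
  subst e
  change (isingLanguage d ρ (m + w)).map cut = _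
  simp only [isingLanguage, language_eq_bind, PMF.map_bind, PMF.bind_bind,
    leavesGivenRoot_map_cut]

lemma isingLanguage_map_block {h w : ℕ} (hw : w ≤ h) :
    (isingLanguage d ρ h).map (block hw) =
      (isingLanguage d ρ (h - w)).bind fun Z =>
        independentLaw fun r => isingGivenRoot d ρ (Z r) w := by
  rw [← isingLanguage_map_subtrees d ρ (Nat.sub_add_cancel hw)]
  congr 1
  funext X r j
  simp only [block]
  congr 1
  apply Fin.ext
  change r.1 * d ^ w + j.1 = j.1 + d ^ w * r.1
  ring

lemma expect_block {h w : ℕ} (hw : w ≤ h) (r : Fin (d ^ (h - w)))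
    (φ : (Fin (d ^ w) → ℤˣ) → ℝ) :
    (expect (isingLanguage d ρ h) fun X => φ (block hw X r)) = expect (isingLanguage d ρ w) φ := by
  rw [← expect_map _ (block hw) fun Y => φ (Y r), isingLanguage_map_block, expect_bind]
  simp only [expect_independentLaw_eval _ r φ, expect_isingGivenRoot, expect_add, expect_const,
    expect_mul_const, expect_language_spin]
  ring

/-- Given the roots, the blocks are independent with conditional expectations affine in the root
spins. The linear terms vanish by symmetry, and only the correlation of the two roots survives. -/
lemma expect_block_mul_block (hd : 1 < d) {h w : ℕ} (hw : w ≤ h) {r s : Fin (d ^ (h - w))}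
    (hrs : r ≠ s) (φ ψ : (Fin (d ^ w) → ℤˣ) → ℝ) :
    (expect (isingLanguage d ρ h) fun X => φ (block hw X r) * ψ (block hw X s)) =
      expect (isingLanguage d ρ w) φ * expect (isingLanguage d ρ w) ψ +
        ((ρ : ℝ) ^ 2) ^ lcaHeight d r s *
          ((∑ y, rootBias d ρ w y * φ y) * ∑ y, rootBias d ρ w y * ψ y) := by
  rw [← expect_map _ (block hw) fun Y => φ (Y r) * ψ (Y s), isingLanguage_map_block, expect_bind]
  simp only [expect_independentLaw_eval_mul _ hrs φ ψ, expect_isingGivenRoot]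
  set a := expect (isingLanguage d ρ w) φ
  set a' := expect (isingLanguage d ρ w) ψ
  set b := ∑ y, rootBias d ρ w y * φ y
  set b' := ∑ y, rootBias d ρ w y * ψ y
  have h1 : ∀ Z : Fin (d ^ (h - w)) → ℤˣ,
      (a + ((Z r : ℤ) : ℝ) * b) * (a' + ((Z s : ℤ) : ℝ) * b') =
        a * a' + (((Z r : ℤ) : ℝ) * (b * a') + (((Z s : ℤ) : ℝ) * (a * b') +
          ((Z r : ℤ) : ℝ) * ((Z s : ℤ) : ℝ) * (b * b'))) := fun Z => by ring
  simp only [h1, expect_add, expect_const, expect_mul_const, expect_language_spin,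
    expect_language_spin_mul_spin d ρ hd]
  ring

lemma toReal_map_block {h w : ℕ} (hw : w ≤ h) (r : Fin (d ^ (h - w))) (y : Fin (d ^ w) → ℤˣ) :
    (((isingLanguage d ρ h).map fun X => block hw X r) y).toReal =
      (isingLanguage d ρ w y).toReal := by
  classical
  rw [toReal_map_apply, expect_block d ρ hw r fun b => if b = y then 1 else 0, expect_indicator]

variable {d}

lemma adjacentPairLaw_toReal (hd : 1 < d) {h w : ℕ} (hw : w ≤ h)
    [Nonempty (Fin (d ^ (h - w) - 1))] (k : ℕ) (y z : Fin (d ^ w) → ℤˣ) :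
    (adjacentPairLaw (isingChannel ρ) rademacher d h w hw ((k, y), z)).toReal =
      (expect (PMF.uniformOfFintype (Fin (d ^ (h - w) - 1))) fun i =>
        if lcaHeight d i.1 (i.1 + 1) = k then 1 else 0) *
        ((isingLanguage d ρ w y).toReal * (isingLanguage d ρ w z).toReal +
          ((ρ : ℝ) ^ 2) ^ k * (rootBias d ρ w y * rootBias d ρ w z)) := by
  classical
  rw [adjacentPairLaw, toReal_bind_apply, ← expect_mul_const]
  congr 1
  funext i
  rw [toReal_map_apply]
  split_ifs with hk
  · have hne : leftIndex i ≠ rightIndex i := fun h => by simp [leftIndex, rightIndex] at h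
    have := expect_block_mul_block d ρ hd hw hne (fun b => if b = y then 1 else 0)
      fun b => if b = z then 1 else 0
    simp only [expect_indicator, mul_ite, mul_one, mul_zero, Finset.sum_ite_eq',
      Finset.mem_univ, if_true] at this
    rw [one_mul, ← hk]
    refine Eq.trans ?_ this
    change expect (isingLanguage d ρ h) _ = _
    congr 1
    funext X
    by_cases h1 : block hw X (leftIndex i) = y <;> by_cases h2 : block hw X (rightIndex i) = z <;>
      simp [h1, h2]
  · simp [hk, expect_const]

variable (d) in
/-- The mean correlation of a uniformly random pair of adjacent spins at level `m`. -/
noncomputable def adjacentCorr (m : ℕ) : ℝ :=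
  (∑ i : Fin (d ^ m - 1), ((ρ : ℝ) ^ 2) ^ lcaHeight d i.1 (i.1 + 1)) / (d ^ m - 1 : ℕ)

lemma varSum_eq {n : ℕ} (p : PMF (Fin n → ℤˣ)) (h0 : (expect p fun X => ∑ i, ((X i : ℤ) : ℝ)) = 0) :
    varSum p = expect p fun X => (∑ i, ((X i : ℤ) : ℝ)) ^ 2 := by
  let : MeasurableSpace (Fin n → ℤˣ) := ⊤
  have hint : ∀ g : (Fin n → ℤˣ) → ℝ, ∫ X, g X ∂p.toMeasure = expect p g := fun g => by
    rw [PMF.integral_eq_sum]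
    rfl
  rw [varSum, ProbabilityTheory.variance_of_integral_eq_zero measurable_from_top.aemeasurable
    ((hint _).trans h0), hint]

lemma varSum_isingLanguage (h : ℕ) : varSum (isingLanguage d ρ h) = leafVariance d ρ h :=
  varSum_eq _ (expect_language_sum_spin d ρ h)

/-! ### The autoregressive transition and its exact variance -/

variable [NeZero d]

lemma nextBlock_none_toReal {h w : ℕ} (hw : w ≤ h) (y : Fin (d ^ w) → ℤˣ) :
    (nextBlock (isingChannel ρ) rademacher d h w hw none y).toReal =
      (isingLanguage d ρ w y).toReal :=
  toReal_map_block d ρ hw 0 y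

lemma nextBlock_some_toReal (hd : 1 < d) (h1 : (ρ : ℝ) < 1) {h w : ℕ} (hw : w ≤ h)
    (hne : Nonempty (Fin (d ^ (h - w) - 1))) (y z : Fin (d ^ w) → ℤˣ) :
    (nextBlock (isingChannel ρ) rademacher d h w hw (some y) z).toReal =
      (isingLanguage d ρ w z).toReal + adjacentCorr d ρ (h - w) * rootMean d ρ w y *
        ((isingLanguage d ρ w z).toReal * rootMean d ρ w z) := by
  classical
  have hy := isingLanguage_pos d ρ h1 w y
  rw [nextBlock, dif_pos hne, heightLaw, PMF.bind_map, toReal_bind_apply]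
  have hi : ∀ i : Fin (d ^ (h - w) - 1),
      (condLaw (adjacentPairLaw (isingChannel ρ) rademacher d h w hw)
        (lcaHeight d i.1 (i.1 + 1), y) z).toReal = (isingLanguage d ρ w z).toReal +
          ((ρ : ℝ) ^ 2) ^ lcaHeight d i.1 (i.1 + 1) * (rootMean d ρ w y * rootBias d ρ w z) := by
    intro i
    set k := lcaHeight d i.1 (i.1 + 1) with hk
    -- The height is sampled from the same pairs as the joint law, so it has positive probability;
    -- together with `hy`, which needs `ρ < 1`, this keeps `condLaw` out of its default branch.
    have hc : 0 < expect (PMF.uniformOfFintype (Fin (d ^ (h - w) - 1))) fun i =>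
        if lcaHeight d i.1 (i.1 + 1) = k then 1 else 0 := by
      rw [expect_uniform]
      refine div_pos (Finset.sum_pos' (fun j _ => by split_ifs <;> norm_num)
        ⟨i, Finset.mem_univ i, ?_⟩) (Nat.cast_pos.mpr Fintype.card_pos)
      rw [if_pos rfl]
      exact one_pos
    set c := expect (PMF.uniformOfFintype (Fin (d ^ (h - w) - 1))) fun i =>
      if lcaHeight d i.1 (i.1 + 1) = k then 1 else 0
    have hsum : ∑ z, (adjacentPairLaw (isingChannel ρ) rademacher d h w hw ((k, y), z)).toReal =
        c * (isingLanguage d ρ w y).toReal := by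
      simp only [adjacentPairLaw_toReal ρ hd hw, ← Finset.mul_sum, Finset.sum_add_distrib,
        sum_toReal, sum_rootBias, mul_zero, add_zero, mul_one]
      rfl
    have hpos : c * (isingLanguage d ρ w y).toReal ≠ 0 := (mul_pos hc hy).ne'
    rw [condLaw_toReal _ _ (by rw [hsum]; exact hpos), hsum, adjacentPairLaw_toReal ρ hd hw,
      ← isingLanguage_mul_rootMean d ρ w y, div_eq_iff hpos]
    ring
  simp only [Function.comp_def, hi, expect_add, expect_const, expect_mul_const, expect_uniform,
    Fintype.card_fin, isingLanguage_mul_rootMean, adjacentCorr]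
  ring

lemma sum_concat {h w : ℕ} (hw : w ≤ h) (Y : Fin (d ^ (h - w)) → Fin (d ^ w) → ℤˣ) :
    ∑ i, (((concat hw Y i : ℤˣ) : ℤ) : ℝ) = ∑ r, ∑ j, ((Y r j : ℤ) : ℝ) := by
  have e : h - w + w = h := Nat.sub_add_cancel hw
  rw [← Fintype.sum_prod_type' fun r j => ((Y r j : ℤ) : ℝ),
    ← ((leafEquiv d (h - w) w).trans (finCongr (congrArg (d ^ ·) e))).sum_comp]
  refine Finset.sum_congr rfl fun x _ => ?_
  have hx : ((((leafEquiv d (h - w) w).trans (finCongr (congrArg (d ^ ·) e))) x : Fin _) : ℕ) =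
      x.2 + d ^ w * x.1 := rfl
  have hpos : 0 < d ^ w := pow_pos (NeZero.pos d) w
  simp only [concat, hx]
  congr 4
  · simp [Nat.add_mul_div_left _ _ hpos, Nat.div_eq_of_lt x.2.2]
  · simp [Nat.mod_eq_of_lt x.2.2]

/-- The chain formula with `f` the spin sum of a block, `m = rootMean` and `a = adjacentCorr`. Then
`E[m²] = q` and `E[f m] = (dρ)^w` by the tower property, and `w < h` provides at least two blocks.
-/
lemma varSum_isingAutoregressive (hd : 1 < d) (h1 : (ρ : ℝ) < 1) {h w : ℕ} (hw : w ≤ h)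
    (hlt : w < h) :
    varSum (isingAutoregressive d ρ h w hw) =
      (d ^ (h - w) : ℕ) * leafVariance d ρ w +
        2 * adjacentCorr d ρ (h - w) * ((d * ρ) ^ w) ^ 2 *
          ∑ i ∈ Finset.range (d ^ (h - w) - 1), ∑ j ∈ Finset.range (i + 1),
            (adjacentCorr d ρ (h - w) * q d ρ w) ^ j := by
  have hN : 1 < d ^ (h - w) := Nat.one_lt_pow (by omega) hd
  have hne : Nonempty (Fin (d ^ (h - w) - 1)) := ⟨⟨0, by omega⟩⟩
  have hnone := nextBlock_none_toReal (d := d) ρ hw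
  have hsome := nextBlock_some_toReal (d := d) ρ hd h1 hw hne
  have hm := expect_rootMean d ρ w
  have hf := expect_language_sum_spin d ρ w
  have hq : (expect (isingLanguage d ρ w) fun y => rootMean d ρ w y * rootMean d ρ w y) =
      q d ρ w := by
    rw [expect_mul_rootMean, sum_rootBias_mul_rootMean]
  have hc := (expect_mul_rootMean d ρ w fun y => ∑ j, ((y j : ℤ) : ℝ)).trans
    (sum_rootBias_mul_sum_spin d ρ w)
  have hsq := expect_generate_sum_sq hnone hsome hm hf (d ^ (h - w))
  have hmean : (expect (generate (nextBlock (isingChannel ρ) rademacher d h w hw) (d ^ (h - w)))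
      fun Y => ∑ r, ∑ j, ((Y r j : ℤ) : ℝ)) = 0 := by
    have := expect_generate_sum hnone hsome hm hf (d ^ (h - w) - 1)
    rwa [Nat.sub_add_cancel hN.le] at this
  rw [hq, hc] at hsq
  rw [varSum_eq, isingAutoregressive, autoregressive, expect_map]
  · simp only [sum_concat]
    exact hsq
  · rw [isingAutoregressive, autoregressive, expect_map]
    simp only [sum_concat]
    exact hmean

end adjacent

/-! ### Asymptotics -/

lemma sum_sum_pow_eq {b : ℝ} (hb : b ≠ 1) (n : ℕ) :
    ∑ i ∈ Finset.range n, ∑ j ∈ Finset.range (i + 1), b ^ j =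
      n / (1 - b) - b * (1 - b ^ n) / (1 - b) ^ 2 := by
  have h1 : 1 - b ≠ 0 := sub_ne_zero.mpr hb.symm
  have h2 : b - 1 ≠ 0 := sub_ne_zero.mpr hb
  induction n with
  | zero => simp
  | succ n ih =>
    rw [Finset.sum_range_succ, ih, geom_sum_eq hb]
    push_cast
    rw [← neg_sub 1 b]
    field_simp
    ring

/-- The double sum is `n / (1 - b)` up to an error that stays bounded, since `b` stays away from
`1`. The denominator is `n + 1` because `n + 1` blocks have `n` adjacent pairs. -/
lemma tendsto_sum_sum_pow_div {b : ℕ → ℝ} {b' : ℝ} {n : ℕ → ℕ} (h0 : ∀ k, 0 ≤ b k)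
    (hb : Tendsto b atTop (𝓝 b')) (hb' : b' < 1) (hn : Tendsto n atTop atTop) :
    Tendsto (fun k => (∑ i ∈ Finset.range (n k), ∑ j ∈ Finset.range (i + 1), b k ^ j) / (n k + 1))
      atTop (𝓝 (1 / (1 - b'))) := by
  have hlt : ∀ᶠ k in atTop, b k < 1 := hb.eventually_lt_const hb'
  have hsub : Tendsto (fun k => 1 - b k) atTop (𝓝 (1 - b')) := tendsto_const_nhds.sub hb
  have hne : 1 - b' ≠ 0 := by linarith
  have hinv : Tendsto (fun k => 1 / ((n k : ℝ) + 1)) atTop (𝓝 0) :=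
    tendsto_one_div_add_atTop_nhds_zero_nat.comp hn
  have h1 : Tendsto (fun k => (1 - 1 / ((n k : ℝ) + 1)) * (1 / (1 - b k))) atTop
      (𝓝 (1 / (1 - b'))) := by
    simpa using ((tendsto_const_nhds (x := (1 : ℝ))).sub hinv).mul (hsub.inv₀ hne)
  have h2 : Tendsto (fun k => b k * (1 - b k ^ n k) / (1 - b k) ^ 2 * (1 / ((n k : ℝ) + 1))) atTop
      (𝓝 0) := by
    have hz : Tendsto (fun k => 1 / (1 - b k) ^ 2 * (1 / ((n k : ℝ) + 1))) atTop (𝓝 0) := by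
      simpa using ((hsub.pow 2).inv₀ (pow_ne_zero 2 hne)).mul hinv
    refine squeeze_zero' ?_ ?_ hz
    · filter_upwards [hlt] with k hk
      have := pow_le_one₀ (n := n k) (h0 k) hk.le
      have := h0 k
      have : 0 ≤ 1 - b k ^ n k := by linarith
      positivity
    · filter_upwards [hlt] with k hk
      have h3 := pow_le_one₀ (n := n k) (h0 k) hk.le
      have h4 := pow_nonneg (h0 k) (n k)
      gcongr
      nlinarith [h0 k]
  refine (by simpa using h1.sub h2 : Tendsto _ atTop (𝓝 (1 / (1 - b')))).congr' ?_
  filter_upwards [hlt] with k hk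
  rw [sum_sum_pow_eq hk.ne]
  have : 1 - b k ≠ 0 := by linarith
  have : (n k : ℝ) + 1 ≠ 0 := by positivity
  field_simp
  ring

lemma tendsto_log_sub {x : ℕ → ℝ} {w : ℕ → ℕ} {l A : ℝ} (hl : 0 < l) (hA : 0 < A)
    (hx : Tendsto (fun n => x n / l ^ w n) atTop (𝓝 A)) :
    Tendsto (fun n => Real.log (x n) - (w n * Real.log l + Real.log A)) atTop (𝓝 0) := by
  have h := (hx.log hA.ne').sub_const (Real.log A)
  rw [sub_self] at h
  refine h.congr' ?_
  filter_upwards [hx.eventually_const_lt hA] with n hn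
  have hx0 : x n ≠ 0 := fun h0 => by simp [h0] at hn
  rw [Real.log_div hx0 (pow_pos hl _).ne', Real.log_pow]
  ring

/-! ### Closed forms and limits of the constants -/

section constants

variable {d : ℕ} {ρ : unitInterval}

lemma one_lt_of_kestenStigum (hKS : 1 < (d : ℝ) * (ρ : ℝ) ^ 2) : 1 < d := by
  have h2 : (ρ : ℝ) ^ 2 ≤ 1 := pow_le_one₀ ρ.2.1 ρ.2.2
  have : (1 : ℝ) < d := hKS.trans_le (mul_le_of_le_one_right d.cast_nonneg h2)
  exact_mod_cast this

lemma constC_pos (hKS : 1 < (d : ℝ) * (ρ : ℝ) ^ 2) : 0 < constC d ρ := by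
  have hd : (1 : ℝ) < d := by exact_mod_cast one_lt_of_kestenStigum hKS
  have : 1 / (d : ℝ) < 1 := (div_lt_one (by linarith)).mpr hd
  exact mul_pos (by linarith) (div_pos (by linarith) (by linarith))

/-- The recursion has the particular solution `-d^h (1 - ρ²) / (dρ² - 1)`; the coefficient of the
homogeneous solution `(d²ρ²)^h` is fixed by the value `1` at height `0`, which gives `constC`. -/
lemma leafVariance_eq (hKS : 1 < (d : ℝ) * (ρ : ℝ) ^ 2) (h : ℕ) :
    leafVariance d ρ h =
      d ^ h * (constC d ρ * (d * (ρ : ℝ) ^ 2) ^ h - (1 - ρ ^ 2) / (d * (ρ : ℝ) ^ 2 - 1)) := by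
  have hd : (d : ℝ) ≠ 0 := by
    have := one_lt_of_kestenStigum hKS
    positivity
  have hl : (d : ℝ) * (ρ : ℝ) ^ 2 - 1 ≠ 0 := by linarith
  induction h with
  | zero =>
    rw [leafVariance_zero, constC]
    field_simp
    ring
  | succ h ih =>
    rw [leafVariance_succ, ih, constC]
    field_simp
    ring

lemma tendsto_leafVariance (hKS : 1 < (d : ℝ) * (ρ : ℝ) ^ 2) :
    Tendsto (fun h : ℕ => ((d : ℝ) ^ h)⁻¹ * leafVariance d ρ h / (d * (ρ : ℝ) ^ 2) ^ h) atTop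
      (𝓝 (constC d ρ)) := by
  have hd : (d : ℝ) ≠ 0 := by
    have := one_lt_of_kestenStigum hKS
    positivity
  have hl : (d : ℝ) * (ρ : ℝ) ^ 2 ≠ 0 := by linarith
  have hinv : Tendsto (fun h : ℕ => (((d : ℝ) * (ρ : ℝ) ^ 2)⁻¹) ^ h) atTop (𝓝 0) :=
    tendsto_pow_atTop_nhds_zero_of_lt_one (by positivity) (inv_lt_one_of_one_lt₀ hKS)
  have := (tendsto_const_nhds (x := constC d ρ)).sub
    (hinv.const_mul ((1 - (ρ : ℝ) ^ 2) / (d * (ρ : ℝ) ^ 2 - 1)))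
  rw [mul_zero, sub_zero] at this
  refine this.congr fun h => ?_
  rw [leafVariance_eq hKS, inv_mul_cancel_left₀ (pow_ne_zero h hd),
    sub_div (_ * _), mul_div_cancel_right₀ _ (pow_ne_zero h hl), inv_pow]
  rfl

lemma alphaStar_eq (hd : 1 < d) :
    alphaStar d ρ = (1 - 1 / (d : ℝ)) * (ρ : ℝ) ^ 2 / (1 - (ρ : ℝ) ^ 2 / d) := by
  have hd' : (1 : ℝ) < d := by exact_mod_cast hd
  have h2 : (ρ : ℝ) ^ 2 ≤ 1 := pow_le_one₀ ρ.2.1 ρ.2.2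
  have hlt : (ρ : ℝ) ^ 2 / d < 1 := (div_lt_one (by linarith)).mpr (by linarith)
  rw [alphaStar, div_eq_mul_inv (_ * _), ← tsum_geometric_of_lt_one (by positivity) hlt, ← tsum_mul_left]
  congr 1
  funext k
  rw [div_pow, div_pow, pow_mul, pow_succ]
  ring

lemma alphaStar_nonneg (hd : 1 < d) : 0 ≤ alphaStar d ρ := by
  have hd' : (1 : ℝ) < d := by exact_mod_cast hd
  have : 1 / (d : ℝ) < 1 := (div_lt_one (by linarith)).mpr hd'
  have h2 : (ρ : ℝ) ^ 2 ≤ 1 := pow_le_one₀ ρ.2.1 ρ.2.2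
  have hlt : (ρ : ℝ) ^ 2 / d < 1 := (div_lt_one (by linarith)).mpr (by linarith)
  rw [alphaStar_eq hd]
  exact div_nonneg (mul_nonneg (by linarith) (sq_nonneg _)) (by linarith)

lemma alphaStar_lt_one (hd : 1 < d) (h1 : (ρ : ℝ) < 1) : alphaStar d ρ < 1 := by
  have hd' : (1 : ℝ) < d := by exact_mod_cast hd
  have h2 : (ρ : ℝ) ^ 2 < 1 := pow_lt_one₀ ρ.2.1 h1 two_ne_zero
  have hlt : (ρ : ℝ) ^ 2 / d < 1 := (div_lt_one (by linarith)).mpr (by linarith)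
  rw [alphaStar_eq hd, div_lt_one (by linarith)]
  have : (1 - 1 / (d : ℝ)) * (ρ : ℝ) ^ 2 = (ρ : ℝ) ^ 2 - (ρ : ℝ) ^ 2 / d := by ring
  linarith

/-! ### The law of the height -/

lemma lcaHeight_succ_of_lt (hd : 1 < d) (N : ℕ) {b : ℕ} (hb : b + 1 < d) :
    lcaHeight d (N * d + b) (N * d + b + 1) = 1 := by
  rw [lcaHeight_of_ne hd (by omega), add_assoc, mul_comm, Nat.mul_add_div (by omega),
    Nat.mul_add_div (by omega), Nat.div_eq_of_lt (by omega), Nat.div_eq_of_lt hb, lcaHeight_self]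

lemma lcaHeight_succ_of_eq (hd : 1 < d) (N : ℕ) {b : ℕ} (hb : b + 1 = d) :
    lcaHeight d (N * d + b) (N * d + b + 1) = lcaHeight d N (N + 1) + 1 := by
  rw [lcaHeight_of_ne hd (by omega), add_assoc, mul_comm, Nat.mul_add_div (by omega),
    Nat.mul_add_div (by omega), Nat.div_eq_of_lt (by omega), hb, Nat.div_self (by omega), add_zero]

/-- Each parent has `d - 1` pairs of adjacent children, all at height `1`. The remaining pair
straddles two adjacent parents and sits one level below their common ancestor height. -/
lemma sum_pow_lcaHeight_mul (hd : 1 < d) (r : ℝ) (N : ℕ) :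
    ∑ i ∈ Finset.range (N * d), r ^ lcaHeight d i (i + 1) =
      N * ((d - 1) * r) + r * ∑ i ∈ Finset.range N, r ^ lcaHeight d i (i + 1) := by
  induction N with
  | zero => simp
  | succ N ih =>
    obtain ⟨c, rfl⟩ : ∃ c, d = c + 1 := ⟨d - 1, by omega⟩
    rw [Nat.succ_mul, Finset.sum_range_add, ih, Finset.sum_range_succ _ c,
      lcaHeight_succ_of_eq hd N rfl, Finset.sum_range_succ _ N]
    have h1 : ∀ b ∈ Finset.range c,
        r ^ lcaHeight (c + 1) (N * (c + 1) + b) (N * (c + 1) + b + 1) = r := fun b hb => by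
      rw [lcaHeight_succ_of_lt hd N (Nat.succ_lt_succ (Finset.mem_range.mp hb)), pow_one]
    rw [Finset.sum_congr rfl h1]
    simp
    ring

lemma adjacentCorr_nonneg (m : ℕ) : 0 ≤ adjacentCorr d ρ m :=
  div_nonneg (Finset.sum_nonneg fun _ _ => by positivity) (Nat.cast_nonneg _)

/-- The sum includes one pair beyond the right end of the level, which makes the recursion exact: an
affine map of slope `ρ² / d < 1` with fixed point `alphaStar`. -/
lemma tendsto_sum_pow_lcaHeight (hd : 1 < d) :
    Tendsto (fun m : ℕ =>
      (∑ i ∈ Finset.range (d ^ m), ((ρ : ℝ) ^ 2) ^ lcaHeight d i (i + 1)) / (d : ℝ) ^ m) atTop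
      (𝓝 (alphaStar d ρ)) := by
  have hd' : (1 : ℝ) < d := by exact_mod_cast hd
  have h2 : (ρ : ℝ) ^ 2 ≤ 1 := pow_le_one₀ ρ.2.1 ρ.2.2
  have hlt : (ρ : ℝ) ^ 2 / d < 1 := (div_lt_one (by linarith)).mpr (by linarith)
  set g : ℕ → ℝ := fun m =>
    (∑ i ∈ Finset.range (d ^ m), ((ρ : ℝ) ^ 2) ^ lcaHeight d i (i + 1)) / (d : ℝ) ^ m with hg
  have hstep : ∀ m, g (m + 1) = (1 - 1 / (d : ℝ)) * (ρ : ℝ) ^ 2 + (ρ : ℝ) ^ 2 / d * g m := by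
    intro m
    simp only [hg, pow_succ d m, sum_pow_lcaHeight_mul hd]
    push_cast
    field_simp
    ring
  have hform : ∀ m, g m = alphaStar d ρ + ((ρ : ℝ) ^ 2 / d) ^ m * (g 0 - alphaStar d ρ) := by
    intro m
    induction m with
    | zero => ring
    | succ m ih =>
      have hfix : alphaStar d ρ =
          (1 - 1 / (d : ℝ)) * (ρ : ℝ) ^ 2 + (ρ : ℝ) ^ 2 / d * alphaStar d ρ := by
        have h3 := alphaStar_eq (ρ := ρ) hd
        rw [eq_div_iff (by linarith)] at h3
        linarith
      rw [hstep, ih, pow_succ]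
      linear_combination -hfix
  have hz := (tendsto_pow_atTop_nhds_zero_of_lt_one (by positivity) hlt).mul_const
    (g 0 - alphaStar d ρ)
  simpa only [zero_mul, add_zero, ← hform] using hz.const_add (alphaStar d ρ)

/-- Dropping the extra pair changes the sum by at most `1`, and replacing `d ^ m` by `d ^ m - 1` is
harmless in the limit. -/
lemma tendsto_adjacentCorr (hd : 1 < d) :
    Tendsto (adjacentCorr d ρ) atTop (𝓝 (alphaStar d ρ)) := by
  have hd' : (1 : ℝ) < d := by exact_mod_cast hd
  have h2 : (ρ : ℝ) ^ 2 ≤ 1 := pow_le_one₀ ρ.2.1 ρ.2.2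
  have hinv : Tendsto (fun m : ℕ => ((d : ℝ)⁻¹) ^ m) atTop (𝓝 0) :=
    tendsto_pow_atTop_nhds_zero_of_lt_one (by positivity) (inv_lt_one_of_one_lt₀ hd')
  have hlast : Tendsto (fun m : ℕ =>
      ((ρ : ℝ) ^ 2) ^ lcaHeight d (d ^ m - 1) (d ^ m - 1 + 1) * ((d : ℝ)⁻¹) ^ m) atTop (𝓝 0) :=
    squeeze_zero (fun m => by positivity)
      (fun m => mul_le_of_le_one_left (by positivity) (pow_le_one₀ (sq_nonneg _) h2)) hinv
  have := ((tendsto_sum_pow_lcaHeight (ρ := ρ) hd).sub hlast).div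
    ((tendsto_const_nhds (x := (1 : ℝ))).sub hinv) (by norm_num)
  simp only [sub_zero, div_one] at this
  refine this.congr' ?_
  filter_upwards [eventually_gt_atTop 0] with m hm
  have hN : 1 < d ^ m := Nat.one_lt_pow hm.ne' hd
  have hN' : (1 : ℝ) < (d : ℝ) ^ m := by exact_mod_cast hN
  have hsum := Finset.sum_range_succ (fun i => ((ρ : ℝ) ^ 2) ^ lcaHeight d i (i + 1)) (d ^ m - 1)
  rw [Nat.sub_add_cancel hN.le] at hsum
  simp only [Pi.div_apply]
  rw [adjacentCorr, ← Finset.sum_range fun i => ((ρ : ℝ) ^ 2) ^ lcaHeight d i (i + 1), hsum,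
    Nat.sub_add_cancel hN.le, Nat.cast_sub hN.le, inv_pow]
  push_cast
  have h3 : (d : ℝ) ^ m - 1 ≠ 0 := by linarith
  have h4 : 1 - ((d : ℝ) ^ m)⁻¹ ≠ 0 := by
    have := inv_lt_one_of_one_lt₀ hN'
    linarith
  rw [div_eq_div_iff h4 h3]
  field_simp
  ring

/-! ### The limiting variance of the autoregressive process -/

lemma qStar_le_one : qStar d ρ ≤ 1 :=
  le_of_tendsto' (tendsto_q d ρ) (q_le_one d ρ)

lemma alphaStar_mul_qStar_lt_one (hd : 1 < d) (h1 : (ρ : ℝ) < 1) :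
    alphaStar d ρ * qStar d ρ < 1 :=
  (mul_le_of_le_one_right (alphaStar_nonneg hd) qStar_le_one).trans_lt (alphaStar_lt_one hd h1)

lemma constC_le_constA (hd : 1 < d) (h1 : (ρ : ℝ) < 1) : constC d ρ ≤ constA d ρ := by
  have := alphaStar_mul_qStar_lt_one hd h1
  have := alphaStar_nonneg (ρ := ρ) hd
  exact le_add_of_nonneg_right (div_nonneg (by linarith) (by linarith))

lemma tendsto_varSum_isingAutoregressive [NeZero d] (hKS : 1 < (d : ℝ) * (ρ : ℝ) ^ 2)
    (h1 : (ρ : ℝ) < 1) {w h : ℕ → ℕ} (hwh : ∀ n, w n ≤ h n) (hw : Tendsto w atTop atTop)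
    (hm : Tendsto (fun n => h n - w n) atTop atTop) :
    Tendsto (fun n => ((d : ℝ) ^ h n)⁻¹ * varSum (isingAutoregressive d ρ (h n) (w n) (hwh n)) /
      (d * (ρ : ℝ) ^ 2) ^ w n) atTop (𝓝 (constA d ρ)) := by
  have hd := one_lt_of_kestenStigum hKS
  have hd0 : (d : ℝ) ≠ 0 := by positivity
  have hl : (d : ℝ) * (ρ : ℝ) ^ 2 ≠ 0 := by linarith
  have ha := (tendsto_adjacentCorr (ρ := ρ) hd).comp hm
  have hq := (tendsto_q d ρ).comp hw
  have hN : Tendsto (fun n => d ^ (h n - w n) - 1) atTop atTop :=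
    (tendsto_sub_atTop_nat 1).comp ((tendsto_pow_atTop_atTop_of_one_lt hd).comp hm)
  have hS := tendsto_sum_sum_pow_div
    (fun n => mul_nonneg (adjacentCorr_nonneg (h n - w n)) (q_nonneg d ρ (w n)))
    (ha.mul hq) (alphaStar_mul_qStar_lt_one hd h1) hN
  have hlim := ((tendsto_leafVariance hKS).comp hw).add ((ha.const_mul 2).mul hS)
  rw [mul_one_div] at hlim
  refine hlim.congr' ?_
  filter_upwards [hm.eventually_gt_atTop 0] with n hn
  have hN1 : 1 ≤ d ^ (h n - w n) := Nat.one_le_pow _ _ (by omega)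
  have hN0 : (d : ℝ) ^ (h n - w n) ≠ 0 := pow_ne_zero _ hd0
  have hw0 : (d : ℝ) ^ w n ≠ 0 := pow_ne_zero _ hd0
  have hl0 := pow_ne_zero (w n) hl
  -- Of the squared covariance `(dρ)^(2w)`, the factor `(dρ²)^w` is the claimed growth. The
  -- remaining `d^w` and the number of blocks together cancel `d^h`.
  have hsq : (((d : ℝ) * ρ) ^ w n) ^ 2 = d ^ w n * (d * (ρ : ℝ) ^ 2) ^ w n := by
    rw [← mul_pow, ← pow_mul, mul_comm (w n), pow_mul]
    ring
  have hpow : (d : ℝ) ^ h n = d ^ (h n - w n) * d ^ w n := by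
    rw [← pow_add, Nat.sub_add_cancel (hwh n)]
  rw [varSum_isingAutoregressive ρ hd h1 (hwh n) (by omega), hsq, hpow]
  simp only [Function.comp, Nat.cast_sub hN1]
  push_cast
  rw [sub_add_cancel]
  generalize (∑ i ∈ Finset.range (d ^ (h n - w n) - 1), _ : ℝ) = T
  generalize ((d : ℝ) * (ρ : ℝ) ^ 2) ^ w n = lw at *
  field_simp

end constants

end Broadcast

theorem theorem1 (d : ℕ) [NeZero d] (ρ : unitInterval) (hKS : 1 < (d : ℝ) * (ρ : ℝ) ^ 2) :
    -- the limit of `q_h` that enters the constant `A` exists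
    Tendsto (q d ρ) atTop (𝓝 (qStar d ρ)) ∧
    0 < constC d ρ ∧
    -- the autoregressive process, as `w → ∞` and `h - w → ∞`
    ((ρ : ℝ) < 1 →
      constC d ρ ≤ constA d ρ ∧
      ∀ (w h : ℕ → ℕ) (hwh : ∀ n, w n ≤ h n),
        Tendsto w atTop atTop → Tendsto (fun n => h n - w n) atTop atTop →
        Tendsto (fun n =>
          Real.log (((d : ℝ) ^ h n)⁻¹ * varSum (isingAutoregressive d ρ (h n) (w n) (hwh n)))
            - (w n * Real.log (d * (ρ : ℝ) ^ 2) + Real.log (constA d ρ))) atTop (𝓝 0)) ∧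
    -- the true process, as `h → ∞`
    Tendsto (fun h : ℕ =>
      Real.log (((d : ℝ) ^ h)⁻¹ * varSum (isingLanguage d ρ h))
        - (h * Real.log (d * (ρ : ℝ) ^ 2) + Real.log (constC d ρ))) atTop (𝓝 0) := by
  have hd := one_lt_of_kestenStigum hKS
  have hl : 0 < (d : ℝ) * (ρ : ℝ) ^ 2 := by linarith
  have hC := constC_pos hKS
  refine ⟨tendsto_q d ρ, hC, fun h1 => ⟨constC_le_constA hd h1, fun w h hwh hw hm => ?_⟩, ?_⟩
  · exact tendsto_log_sub hl (hC.trans_le (constC_le_constA hd h1))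
      (tendsto_varSum_isingAutoregressive hKS h1 hwh hw hm)
  · simp only [varSum_isingLanguage]
    -- Here the growth exponent is the height itself.
    exact tendsto_log_sub (w := id) hl hC (tendsto_leafVariance hKS)
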